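/- Let $\gamma>0$ be fixed and, for $k\in\mathbb N$, let $p=p_k$ and $n_0=n_{0,k},n_1=n_{1,k}$ be integers with $p,n_0,n_1\to\infty$ as $k\to\infty$; the index $k$ is suppressed below and all limits and $O,o$ are for $k\to\infty$. For $i\in\{0,1\}$ let $\mu_i\in\mathbb R^p$, let $\Sigma_i\in\mathbb R^{p\times p}$ be symmetric positive semidefinite, and let $\pi_0,\pi_1>0$ with $\pi_0+\pi_1=1$ be the priors (possibly depending on $k$). On a common probability space, let the training samples $x_{i,1},\dots,x_{i,n_i}$, $i\in\{0,1\}$, be, for each $k$, mutually independent with $x_{i,l}\sim\mathcal N(\mu_i,\Sigma_i)$ (no assumption is made on the joint law for different $k$). Put $$\hat\mu_i=\frac1{n_i}\sum_{l}x_{i,l},\qquad \hat\Sigma_i=\frac1{n_i-1}\sum_l (x_{i,l}-\hat\mu_i)(x_{i,l}-\hat\mu_i)^T,\qquad H_i=(I_p+\gamma\hat\Sigma_i)^{-1},$$ $$\widehat W(x)=\tfrac12\log\frac{|H_0|}{|H_1|}-\tfrac12(x-\hat\mu_0)^TH_0(x-\hat\mu_0)+\tfrac12(x-\hat\mu_1)^TH_1(x-\hat\mu_1)-\log\frac{\pi_1}{\pi_0},$$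 where $|\cdot|$ is the determinant, and let the R-QDA conditional error of class $i$ be $$\varepsilon_i=\mathbb P\big[(-1)^i\widehat W(x)<0\ \big|\ \text{training samples}\big],\qquad x\sim\mathcal N(\mu_i,\Sigma_i)\text{ independent of the training samples.}$$ Put $$B_i=\Sigma_i^{1/2}(H_1-H_0)\Sigma_i^{1/2},\qquad r_i=\Sigma_i^{1/2}\big[H_1(\mu_i-\hat\mu_1)-H_0(\mu_i-\hat\mu_0)\big],$$ $$\xi_i=-\log\frac{|H_0|}{|H_1|}+(\mu_i-\hat\mu_0)^TH_0(\mu_i-\hat\mu_0)-(\mu_i-\hat\mu_1)^TH_1(\mu_i-\hat\mu_1)+2\log\frac{\pi_1}{\pi_0}.$$ Assume that 1. $n_0-n_1=o(1)$ and $p/(n_0+n_1)\to c$ for some $c\in(0,\infty)$; 2. $\|\mu_0-\mu_1\|^2=O(\sqrt p)$ (Euclidean norm); 3. $\|\Sigma_i\|=O(1)$ for $i\in\{0,1\}$ (spectral norm); 4. $\Sigma_0-\Sigma_1$ has $O(\sqrt p)$ eigenvalues (with multiplicity) of order $O(1)$, and its remaining eigenvalues are of order $O(1/\sqrt p)$,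 uniformly; 5. for $i\in\{0,1\}$, almost surely, $2\operatorname{tr}B_i^2+4\|r_i\|^2>0$ for all large $k$ and $$\frac{60\operatorname{tr}B_i^2+240\operatorname{tr}B_i^2\,\|r_i\|^2+48\|r_i\|^4}{\big(2\operatorname{tr}B_i^2+4\|r_i\|^2\big)^2}\longrightarrow0 .$$ Then, for $i\in\{0,1\}$, with $\Phi$ the standard normal distribution function, $$\varepsilon_i-\Phi\left((-1)^i\,\frac{\xi_i-\operatorname{tr}B_i}{\sqrt{2\operatorname{tr}B_i^2+4\|r_i\|^2}}\right)\longrightarrow0\quad\text{almost surely.}$$ -/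

import Mathlib

open MeasureTheory ProbabilityTheory Filter Topology Matrix
open scoped MatrixOrder

namespace RQDA

noncomputable section

/-- The product `A v` of a real matrix and a vector of Euclidean space. -/
def act {p : ℕ} (A : Matrix (Fin p) (Fin p) ℝ) (v : EuclideanSpace ℝ (Fin p)) :
    EuclideanSpace ℝ (Fin p) :=
  Matrix.toEuclideanCLM (𝕜 := ℝ) A v

/-- The quadratic form `vᵀ A v`. -/
def quad {p : ℕ} (A : Matrix (Fin p) (Fin p) ℝ) (v : EuclideanSpace ℝ (Fin p)) : ℝ :=
  inner ℝ v (act A v)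

/-- The spectral norm of a real square matrix. -/
def specNorm {p : ℕ} (A : Matrix (Fin p) (Fin p) ℝ) : ℝ :=
  ‖Matrix.toEuclideanCLM (𝕜 := ℝ) A‖

/-- The sample mean of `x₁, …, xₙ`. -/
def sampleMean {p n : ℕ} (x : Fin n → EuclideanSpace ℝ (Fin p)) : EuclideanSpace ℝ (Fin p) :=
  (1 / (n : ℝ)) • ∑ l, x l

/-- The sample covariance matrix `(n - 1)⁻¹ ∑ (x_l - m) (x_l - m)ᵀ`, `m` the sample mean. -/
def sampleCov {p n : ℕ} (x : Fin n → EuclideanSpace ℝ (Fin p)) : Matrix (Fin p) (Fin p) ℝ :=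
  (1 / ((n : ℝ) - 1)) •
    ∑ l, Matrix.vecMulVec (x l - sampleMean x).ofLp (x l - sampleMean x).ofLp

/-- The ridge estimator `H = (I + γ Σ̂)⁻¹` of the inverse covariance matrix. -/
def ridge {p n : ℕ} (γ : ℝ) (x : Fin n → EuclideanSpace ℝ (Fin p)) :
    Matrix (Fin p) (Fin p) ℝ :=
  (1 + γ • sampleCov x)⁻¹

/-- The R-QDA discriminant at the point `y`, with training samples `x i` of class `i` and priors
`π i`. -/
def discriminant {p : ℕ} {n : Fin 2 → ℕ} (γ : ℝ) (π : Fin 2 → ℝ)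
    (x : (i : Fin 2) → Fin (n i) → EuclideanSpace ℝ (Fin p)) (y : EuclideanSpace ℝ (Fin p)) : ℝ :=
  (1 / 2) * Real.log ((ridge γ (x 0)).det / (ridge γ (x 1)).det)
    - (1 / 2) * quad (ridge γ (x 0)) (y - sampleMean (x 0))
    + (1 / 2) * quad (ridge γ (x 1)) (y - sampleMean (x 1))
    - Real.log (π 1 / π 0)

/-- The R-QDA classification error of class `i` conditional on the training samples `x`: the
probability that a fresh observation `y` of law `N(m i, S i)` satisfies `(-1)^i Ŵ(y) < 0`. -/
def condError {p : ℕ} {n : Fin 2 → ℕ} (γ : ℝ) (π : Fin 2 → ℝ)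
    (m : Fin 2 → EuclideanSpace ℝ (Fin p)) (S : Fin 2 → Matrix (Fin p) (Fin p) ℝ)
    (x : (i : Fin 2) → Fin (n i) → EuclideanSpace ℝ (Fin p)) (i : Fin 2) : ℝ :=
  (multivariateGaussian (m i) (S i)).real {y | (-1 : ℝ) ^ (i : ℕ) * discriminant γ π x y < 0}

/-- `B_i = Σ_i^{1/2} (H₁ - H₀) Σ_i^{1/2}`. -/
def matB {p : ℕ} {n : Fin 2 → ℕ} (γ : ℝ) (S : Fin 2 → Matrix (Fin p) (Fin p) ℝ)
    (x : (i : Fin 2) → Fin (n i) → EuclideanSpace ℝ (Fin p)) (i : Fin 2) :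
    Matrix (Fin p) (Fin p) ℝ :=
  CFC.sqrt (S i) * (ridge γ (x 1) - ridge γ (x 0)) * CFC.sqrt (S i)

/-- `r_i = Σ_i^{1/2} [H₁ (m_i - m̂₁) - H₀ (m_i - m̂₀)]`. -/
def vecR {p : ℕ} {n : Fin 2 → ℕ} (γ : ℝ)
    (m : Fin 2 → EuclideanSpace ℝ (Fin p)) (S : Fin 2 → Matrix (Fin p) (Fin p) ℝ)
    (x : (i : Fin 2) → Fin (n i) → EuclideanSpace ℝ (Fin p)) (i : Fin 2) :
    EuclideanSpace ℝ (Fin p) :=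
  act (CFC.sqrt (S i))
    (act (ridge γ (x 1)) (m i - sampleMean (x 1)) - act (ridge γ (x 0)) (m i - sampleMean (x 0)))

/-- `ξ_i = -log (|H₀| / |H₁|) + (m_i - m̂₀)ᵀ H₀ (m_i - m̂₀) - (m_i - m̂₁)ᵀ H₁ (m_i - m̂₁)
+ 2 log (π₁ / π₀)`. -/
def xi {p : ℕ} {n : Fin 2 → ℕ} (γ : ℝ) (π : Fin 2 → ℝ)
    (m : Fin 2 → EuclideanSpace ℝ (Fin p))
    (x : (i : Fin 2) → Fin (n i) → EuclideanSpace ℝ (Fin p)) (i : Fin 2) : ℝ :=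
  -Real.log ((ridge γ (x 0)).det / (ridge γ (x 1)).det)
    + quad (ridge γ (x 0)) (m i - sampleMean (x 0))
    - quad (ridge γ (x 1)) (m i - sampleMean (x 1))
    + 2 * Real.log (π 1 / π 0)

/-- `s_i² = 2 tr B_i² + 4 ‖r_i‖²`. -/
def totalVar {p : ℕ} {n : Fin 2 → ℕ} (γ : ℝ)
    (m : Fin 2 → EuclideanSpace ℝ (Fin p)) (S : Fin 2 → Matrix (Fin p) (Fin p) ℝ)
    (x : (i : Fin 2) → Fin (n i) → EuclideanSpace ℝ (Fin p)) (i : Fin 2) : ℝ :=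
  2 * (matB γ S x i ^ 2).trace + 4 * ‖vecR γ m S x i‖ ^ 2

/-- The ratio `(60 tr B_i² + 240 tr B_i² ‖r_i‖² + 48 ‖r_i‖⁴) / (2 tr B_i² + 4 ‖r_i‖²)²`. -/
def lyapunovRatio {p : ℕ} {n : Fin 2 → ℕ} (γ : ℝ)
    (m : Fin 2 → EuclideanSpace ℝ (Fin p)) (S : Fin 2 → Matrix (Fin p) (Fin p) ℝ)
    (x : (i : Fin 2) → Fin (n i) → EuclideanSpace ℝ (Fin p)) (i : Fin 2) : ℝ :=
  (60 * (matB γ S x i ^ 2).trace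
      + 240 * (matB γ S x i ^ 2).trace * ‖vecR γ m S x i‖ ^ 2
      + 48 * ‖vecR γ m S x i‖ ^ 4) / totalVar γ m S x i ^ 2

/-- A sequence of symmetric matrices `D k` of sizes `p k` has `O(√p)` eigenvalues of order `O(1)`,
and all its other eigenvalues are of order `O(1/√p)`. Eigenvalues are counted with
multiplicity; `J` is the set of indices of those of order `O(1)`. -/
def EigenvalueSplit (p : ℕ → ℕ) (D : (k : ℕ) → Matrix (Fin (p k)) (Fin (p k)) ℝ)
    (hD : ∀ k, (D k).IsHermitian) : Prop :=
  ∃ M : ℝ, 0 < M ∧ ∀ᶠ k in atTop, ∃ J : Finset (Fin (p k)),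
    (J.card : ℝ) ≤ M * √(p k : ℝ) ∧
    (∀ j ∈ J, |(hD k).eigenvalues j| ≤ M) ∧
    (∀ j, j ∉ J → |(hD k).eigenvalues j| ≤ M / √(p k : ℝ))

end

end RQDA

/-! Once the training samples are frozen, the discriminant is a quadratic polynomial of a Gaussian
vector. Writing `x = μ_i + Σ_i^{1/2} z` gives `2Ŵ = zᵀ B_i z + 2 r_iᵀ z - ξ_i` (`discriminant_eq`).
In an eigenbasis of `B_i`, with eigenvalues `λ_j` and coordinates `b_j` of `r_i`, this is `∑ (λ_j
(z_j² - 1) + 2 b_j z_j) - (ξ_i - tr B_i)` with independent standard Gaussian `z_j`. The sum is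
centred with variance `2 tr B_i² + 4 ‖r_i‖²`, so the error is the probability that a standardized
sum of independent variables lies on one side of a threshold (`condError_eq_standardizedLaw`).

Lyapunov's theorem applies because the fourth moments add up to at most a constant times `∑ (λ_j⁴ +
b_j⁴)`. Since `0 ≤ H ≤ I`, each `|λ_j|` is at most `‖Σ_i‖ = O(1)`; hence `∑ λ_j⁴ = O(tr B_i²)`,
while `∑ b_j⁴ ≤ ‖r_i‖⁴`. Divided by the squared variance, this is dominated by the ratio assumed to
vanish (`sum_pow_four_div_le_lyapunovRatio`).

The threshold moves with `k`, so pointwise convergence of distribution functions is not enough;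
continuity of `Φ` makes it uniform (`tendsto_measureReal_sub_cdf_of_tendsto`). -/

/-! ### Lyapunov's central limit theorem by characteristic functions -/

/-- Second order Taylor bound for the exponential on the imaginary axis. -/
lemma norm_exp_mul_I_sub_taylor_le (y : ℝ) :
    ‖Complex.exp (y * Complex.I) - (1 + y * Complex.I - y ^ 2 / 2)‖ ≤ 4 * |y| ^ 3 := by
  have hn : ‖(y : ℂ) * Complex.I‖ = |y| := by simp
  have hI : ((y : ℂ) * Complex.I) ^ 2 = -(y : ℂ) ^ 2 := by
    rw [mul_pow, Complex.I_sq]; ring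
  by_cases hy : |y| ≤ 1
  · have h := Complex.exp_bound (x := y * Complex.I) (by rwa [hn]) (n := 3) (by norm_num)
    rw [hn] at h
    have e : ∑ m ∈ Finset.range 3, ((y : ℂ) * Complex.I) ^ m / (m.factorial : ℂ)
        = 1 + y * Complex.I - y ^ 2 / 2 := by
      simp [Finset.sum_range_succ, hI]; ring
    rw [e] at h
    refine h.trans ?_
    norm_num [Nat.factorial]
    nlinarith [pow_nonneg (abs_nonneg y) 3]
  -- Here every term is dominated by `|y|³`: the total is at most `(1 + 1 + 1 + 1/2) |y|³`.
  · push Not at hy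
    have h1 : ‖Complex.exp (y * Complex.I)‖ = 1 := Complex.norm_exp_ofReal_mul_I y
    have h2 : ‖(1 : ℂ) + y * Complex.I - y ^ 2 / 2‖ ≤ 1 + |y| + |y| ^ 2 / 2 := by
      refine (norm_sub_le _ _).trans (add_le_add ((norm_add_le _ _).trans ?_) ?_)
      · simp
      · simp
    have h3 : |y| ≤ |y| ^ 3 := le_self_pow₀ hy.le (by norm_num)
    have h4 : |y| ^ 2 ≤ |y| ^ 3 := pow_le_pow_right₀ hy.le (by norm_num)
    refine (norm_sub_le _ _).trans ?_
    rw [h1]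
    linarith

/-- Factors are exchanged one at a time; the remaining factors have norm at most one and do not
enlarge the difference. -/
lemma Finset.norm_prod_sub_prod_le_sum {ι : Type*} (s : Finset ι) (a b : ι → ℂ)
    (ha : ∀ i, ‖a i‖ ≤ 1) (hb : ∀ i, ‖b i‖ ≤ 1) :
    ‖∏ i ∈ s, a i - ∏ i ∈ s, b i‖ ≤ ∑ i ∈ s, ‖a i - b i‖ := by
  classical
  induction s using Finset.induction_on with
  | empty => simp
  | insert i s hi ih =>
    rw [Finset.prod_insert hi, Finset.prod_insert hi, Finset.sum_insert hi]
    have e : a i * ∏ j ∈ s, a j - b i * ∏ j ∈ s, b j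
        = (a i - b i) * ∏ j ∈ s, a j + b i * (∏ j ∈ s, a j - ∏ j ∈ s, b j) := by ring
    rw [e]
    refine (norm_add_le _ _).trans (add_le_add ?_ ?_)
    · rw [norm_mul]
      refine mul_le_of_le_one_right (norm_nonneg _) ?_
      rw [norm_prod]
      exact Finset.prod_le_one (fun _ _ => norm_nonneg _) fun j _ => ha j
    · rw [norm_mul]
      exact (mul_le_of_le_one_left (norm_nonneg _) (hb i)).trans ih

lemma abs_exp_neg_sub_le {a : ℝ} (ha : 0 ≤ a) : |Real.exp (-a) - (1 - a)| ≤ a ^ 2 := by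
  by_cases h : a ≤ 1
  · have := Real.norm_exp_sub_one_sub_id_le (x := -a) (by simpa [abs_of_nonneg ha] using h)
    simp only [Real.norm_eq_abs, abs_neg, sq_abs] at this
    convert this using 2
    ring
  · push Not at h
    have h1 : Real.exp (-a) ≤ 1 := Real.exp_le_one_iff.2 (by linarith)
    have h2 := Real.exp_pos (-a)
    have h3 := Real.add_one_le_exp (-a)
    rw [abs_of_nonneg (by linarith)]
    nlinarith

section CharFunBound

variable {μ : Measure ℝ} [IsProbabilityMeasure μ]

lemma integrable_pow_of_memLp_four (h : MemLp id 4 μ) {k : ℕ} (hk : k ≤ 4) :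
    Integrable (fun x : ℝ => x ^ k) μ := by
  have h' : MemLp id (k : ENNReal) μ := h.mono_exponent (by exact_mod_cast hk)
  have := h'.integrable_norm_pow'
  refine (integrable_norm_iff (by fun_prop)).1 ?_
  simpa using this

/-- The variance of `x²` is nonnegative. -/
lemma sq_integral_sq_le_integral_pow_four (h : MemLp id 4 μ) :
    (∫ x, x ^ 2 ∂μ) ^ 2 ≤ ∫ x, x ^ 4 ∂μ := by
  set s := ∫ x, x ^ 2 ∂μ with hs
  have i2 := integrable_pow_of_memLp_four h (k := 2) (by norm_num)
  have i4 := integrable_pow_of_memLp_four h (k := 4) le_rfl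
  have h0 : 0 ≤ ∫ x, (x ^ 2 - s) ^ 2 ∂μ := integral_nonneg fun x => sq_nonneg _
  have e : ∫ x, (x ^ 2 - s) ^ 2 ∂μ = (∫ x, x ^ 4 ∂μ) - 2 * s * s + s ^ 2 := by
    have e' : ∀ x : ℝ, (x ^ 2 - s) ^ 2 = x ^ 4 - 2 * s * x ^ 2 + s ^ 2 := fun x => by ring
    simp_rw [e']
    rw [integral_add (by exact i4.sub (i2.const_mul _)) (integrable_const _),
      integral_sub i4 (i2.const_mul _), integral_const_mul, ← hs]
    simp
  nlinarith

/-- Distance of the characteristic function of a centred law to that of the Gaussian law with the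
same variance. -/
lemma norm_charFun_sub_exp_le (h : MemLp id 4 μ) (h0 : ∫ x, x ∂μ = 0) (t : ℝ) {δ : ℝ}
    (hδ : 0 < δ) :
    ‖charFun μ t - Complex.exp (-(((∫ x, x ^ 2 ∂μ) * t ^ 2 / 2 : ℝ) : ℂ))‖
      ≤ 4 * |t| ^ 3 * (δ * ∫ x, x ^ 2 ∂μ) + 4 * |t| ^ 3 * ((∫ x, x ^ 4 ∂μ) / δ)
        + t ^ 4 * ∫ x, x ^ 4 ∂μ := by
  have i1 := integrable_pow_of_memLp_four h (k := 1) (by norm_num)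
  have i2 := integrable_pow_of_memLp_four h (k := 2) (by norm_num)
  have i4 := integrable_pow_of_memLp_four h (k := 4) le_rfl
  simp only [pow_one] at i1
  set s := ∫ x, x ^ 2 ∂μ with hs
  set q := ∫ x, x ^ 4 ∂μ with hq
  have hs0 : 0 ≤ s := integral_nonneg fun x => sq_nonneg _
  have hsq : s ^ 2 ≤ q := sq_integral_sq_le_integral_pow_four h
  have iT : Integrable (fun x : ℝ => (1 : ℂ) + ((t * x : ℝ) : ℂ) * Complex.I
      - ((t * x : ℝ) : ℂ) ^ 2 / 2) μ := by
    refine ((integrable_const _).add (((i1.const_mul t).ofReal (𝕜 := ℂ)).mul_const _)).sub ?_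
    refine Integrable.div_const ?_ _
    have := (i2.const_mul (t ^ 2)).ofReal (𝕜 := ℂ)
    refine this.congr (.of_forall fun x => ?_)
    simp [mul_pow]
  have iE : Integrable (fun x : ℝ => Complex.exp (((t * x : ℝ) : ℂ) * Complex.I)) μ := by
    refine Integrable.of_bound (C := 1) (by fun_prop) (.of_forall fun x => ?_)
    rw [Complex.norm_exp_ofReal_mul_I]
  have eT : ∫ x : ℝ, ((1 : ℂ) + ((t * x : ℝ) : ℂ) * Complex.I - ((t * x : ℝ) : ℂ) ^ 2 / 2) ∂μ
      = ((1 - s * t ^ 2 / 2 : ℝ) : ℂ) := by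
    rw [integral_sub, integral_add (integrable_const _), integral_mul_const, integral_div]
    · have a1 : ∫ x : ℝ, ((t * x : ℝ) : ℂ) ∂μ = 0 := by
        rw [integral_complex_ofReal, integral_const_mul, h0]; simp
      have a2 : ∫ x : ℝ, ((t * x : ℝ) : ℂ) ^ 2 ∂μ = ((t ^ 2 * s : ℝ) : ℂ) := by
        rw [hs, ← integral_const_mul, ← integral_complex_ofReal]
        refine integral_congr_ae (.of_forall fun x => ?_)
        simp [mul_pow]
      rw [a1, a2]
      simp
      ring
    · exact ((i1.const_mul t).ofReal (𝕜 := ℂ)).mul_const _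
    · exact (integrable_const _).add (((i1.const_mul t).ofReal (𝕜 := ℂ)).mul_const _)
    · refine Integrable.div_const ?_ _
      have := (i2.const_mul (t ^ 2)).ofReal (𝕜 := ℂ)
      refine this.congr (.of_forall fun x => ?_)
      simp [mul_pow]
  have b1 : ‖charFun μ t - ((1 - s * t ^ 2 / 2 : ℝ) : ℂ)‖
      ≤ 4 * |t| ^ 3 * (δ * s + q / δ) := by
    rw [charFun_apply_real, ← eT]
    have : ∫ x : ℝ, Complex.exp (t * x * Complex.I) ∂μ
        = ∫ x : ℝ, Complex.exp (((t * x : ℝ) : ℂ) * Complex.I) ∂μ := by simp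
    rw [this, ← integral_sub iE iT]
    have e : 4 * |t| ^ 3 * (δ * s + q / δ)
        = ∫ x : ℝ, 4 * |t| ^ 3 * (δ * x ^ 2 + x ^ 4 / δ) ∂μ := by
      rw [integral_const_mul, integral_add (i2.const_mul _) (i4.div_const _), integral_const_mul,
        integral_div]
    rw [e]
    refine norm_integral_le_of_norm_le
      (((i2.const_mul _).add (i4.div_const _)).const_mul _) (.of_forall fun x => ?_)
    refine (norm_exp_mul_I_sub_taylor_le (t * x)).trans ?_
    rw [abs_mul, mul_pow, ← mul_assoc]
    refine mul_le_mul_of_nonneg_left ?_ (by positivity)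
    -- The cubic Taylor remainder is absorbed by `|x|³ ≤ δ x² + x⁴ / δ`, so only second and fourth
    -- moments appear and `δ` stays free.
    have k : δ * |x| ^ 2 + |x| ^ 4 / δ - |x| ^ 3
        = |x| ^ 2 / δ * ((δ - |x| / 2) ^ 2 + 3 / 4 * |x| ^ 2) := by
      field_simp; ring
    have k2 : 0 ≤ |x| ^ 2 / δ * ((δ - |x| / 2) ^ 2 + 3 / 4 * |x| ^ 2) := by positivity
    rw [← sq_abs x, show x ^ 4 = |x| ^ 4 by rw [← abs_pow, abs_of_nonneg (by positivity)]]
    linarith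
  have b2 : ‖((1 - s * t ^ 2 / 2 : ℝ) : ℂ) - Complex.exp (-((s * t ^ 2 / 2 : ℝ) : ℂ))‖
      ≤ t ^ 4 * q := by
    rw [← Complex.ofReal_neg, ← Complex.ofReal_exp, ← Complex.ofReal_sub, Complex.norm_real,
      Real.norm_eq_abs, abs_sub_comm]
    refine (abs_exp_neg_sub_le (by positivity)).trans ?_
    have : t ^ 4 * s ^ 2 ≤ t ^ 4 * q := mul_le_mul_of_nonneg_left hsq (by positivity)
    have : 0 ≤ t ^ 4 * s ^ 2 := by positivity
    nlinarith
  have b3 := norm_sub_le_norm_sub_add_norm_sub (charFun μ t) ((1 - s * t ^ 2 / 2 : ℝ) : ℂ)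
    (Complex.exp (-((s * t ^ 2 / 2 : ℝ) : ℂ)))
  linarith

end CharFunBound

/-- **Lyapunov's central limit theorem** for triangular arrays, with fourth moments. -/
theorem tendsto_sum_pi_gaussianReal_of_lyapunov {p : ℕ → ℕ} (μ : (k : ℕ) → Fin (p k) → Measure ℝ)
    [∀ k j, IsProbabilityMeasure (μ k j)] (hmem : ∀ k j, MemLp id 4 (μ k j))
    (hmean : ∀ k j, ∫ x, x ∂(μ k j) = 0)
    (hvar : ∀ᶠ k in atTop, ∑ j, ∫ x, x ^ 2 ∂(μ k j) = 1)
    (hlyap : Tendsto (fun k => ∑ j, ∫ x, x ^ 4 ∂(μ k j)) atTop (𝓝 0))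
    (ν : ℕ → ProbabilityMeasure ℝ)
    (hν : ∀ k, (ν k : Measure ℝ) = (Measure.pi (μ k)).map (fun x => ∑ j, x j))
    (ν₀ : ProbabilityMeasure ℝ) (hν₀ : (ν₀ : Measure ℝ) = gaussianReal 0 1) :
    Tendsto ν atTop (𝓝 ν₀) := by
  refine ProbabilityMeasure.tendsto_of_tendsto_charFun fun t => ?_
  set L : ℕ → ℝ := fun k => ∑ j, ∫ x, x ^ 4 ∂(μ k j) with hL
  -- Both `δ` and `L / δ` must tend to zero, which suggests `δ = √L`; the summand `1 / (k + 1)`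
  -- keeps `δ` positive when `L k = 0`.
  set δ : ℕ → ℝ := fun k => √(L k) + 1 / ((k : ℝ) + 1) with hδ
  have hL0 : ∀ k, 0 ≤ L k := fun k =>
    Finset.sum_nonneg fun j _ => integral_nonneg fun x => by positivity
  have hsqrt : Tendsto (fun k => √(L k)) atTop (𝓝 0) := by
    have := (Real.continuous_sqrt.tendsto 0).comp hlyap
    rwa [Real.sqrt_zero] at this
  have hδ0 : Tendsto δ atTop (𝓝 0) := by
    have := hsqrt.add (tendsto_one_div_add_atTop_nhds_zero_nat (𝕜 := ℝ))
    rwa [add_zero] at this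
  have hlim : Tendsto (fun k => 4 * |t| ^ 3 * δ k + 4 * |t| ^ 3 * √(L k) + t ^ 4 * L k) atTop
      (𝓝 0) := by
    simpa using ((hδ0.const_mul (4 * |t| ^ 3)).add (hsqrt.const_mul (4 * |t| ^ 3))).add
      (hlyap.const_mul (t ^ 4))
  rw [tendsto_iff_norm_sub_tendsto_zero]
  refine squeeze_zero' (.of_forall fun k => norm_nonneg _) ?_ hlim
  filter_upwards [hvar] with k hk
  have hδk : 0 < δ k := by positivity
  have e1 : charFun (ν k : Measure ℝ) t = ∏ j, charFun (μ k j) t := by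
    rw [hν, charFun_map_sum_pi_eq_prod, Finset.prod_apply]
  have e2 : charFun (ν₀ : Measure ℝ) t
      = ∏ j, Complex.exp (-(((∫ x, x ^ 2 ∂(μ k j)) * t ^ 2 / 2 : ℝ) : ℂ)) := by
    rw [hν₀, charFun_gaussianReal, ← Complex.exp_sum,
      Finset.sum_neg_distrib, ← Complex.ofReal_sum, ← Finset.sum_div, ← Finset.sum_mul, hk]
    simp
  rw [e1, e2]
  refine (Finset.norm_prod_sub_prod_le_sum _ _ _ (fun j => norm_charFun_le_one _) fun j => ?_).trans
    ?_
  · rw [← Complex.ofReal_neg, ← Complex.ofReal_exp, Complex.norm_real, Real.norm_eq_abs,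
      Real.abs_exp, Real.exp_le_one_iff, neg_nonpos]
    have : 0 ≤ ∫ x, x ^ 2 ∂(μ k j) := integral_nonneg fun x => sq_nonneg _
    positivity
  · refine (Finset.sum_le_sum fun j _ =>
      norm_charFun_sub_exp_le (hmem k j) (hmean k j) t hδk).trans ?_
    rw [Finset.sum_add_distrib, Finset.sum_add_distrib, ← Finset.mul_sum, ← Finset.mul_sum,
      ← Finset.mul_sum, ← Finset.mul_sum, ← Finset.sum_div, hk, mul_one]
    have : L k / δ k ≤ √(L k) := by
      rw [div_le_iff₀ hδk]
      have h1 := Real.mul_self_sqrt (hL0 k)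
      have h2 : 0 ≤ √(L k) * (1 / ((k : ℝ) + 1)) := by positivity
      simp only [hδ]
      nlinarith
    gcongr

/-! ### Weak convergence along varying thresholds -/

lemma continuous_cdf (μ : Measure ℝ) [IsProbabilityMeasure μ] [NullSingletonClass μ] :
    Continuous (cdf μ) := by
  refine continuous_iff_continuousAt.2 fun q => ?_
  rw [(cdf μ).mono.continuousAt_iff_leftLim_eq_rightLim, (cdf μ).rightLim_eq]
  refine le_antisymm ((cdf μ).mono.leftLim_le le_rfl) ?_
  have h := (cdf μ).measure_singleton q
  rw [measure_cdf, measure_singleton, eq_comm, ENNReal.ofReal_eq_zero] at h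
  linarith

/-- **Pólya's theorem**, in the form of convergence along varying thresholds. -/
theorem tendsto_measureReal_sub_cdf_of_tendsto {ν : ℕ → ProbabilityMeasure ℝ}
    {μ : ProbabilityMeasure ℝ} [NullSingletonClass (μ : Measure ℝ)] (h : Tendsto ν atTop (𝓝 μ))
    (A : ℕ → Set ℝ) (x : ℕ → ℝ) (hA : ∀ k, Set.Iio (x k) ⊆ A k) (hA' : ∀ k, A k ⊆ Set.Iic (x k)) :
    Tendsto (fun k => (ν k : Measure ℝ).real (A k) - cdf (μ : Measure ℝ) (x k)) atTop (𝓝 0) := by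
  set F := cdf (μ : Measure ℝ) with hF
  have hpt : ∀ q : ℝ, Tendsto (fun k => (ν k : Measure ℝ).real (Set.Iic q)) atTop (𝓝 (F q)) := by
    intro q
    have := ProbabilityMeasure.tendsto_measure_of_null_frontier_of_tendsto' h
      (E := Set.Iic q) (by rw [frontier_Iic]; exact measure_singleton q)
    rw [hF, cdf_eq_real]
    exact (ENNReal.tendsto_toReal (measure_ne_top _ _)).comp this
  have hcont : Continuous F := continuous_cdf _
  rw [Metric.tendsto_atTop]
  intro ε hε
  obtain ⟨N, hN⟩ := exists_nat_gt (2 / ε)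
  have hN0 : (0 : ℝ) < N := lt_trans (by positivity) hN
  have hN0' : 0 < N := by exact_mod_cast hN0
  -- Quantiles at the levels `j / N` form a finite grid. The levels `0` and `1` may not be attained,
  -- so `q j` is arbitrary there, and the trivial bounds `0` and `1` for probabilities replace it.
  have hq : ∀ j : ℕ, ∃ q : ℝ, 0 < j → j < N → F q = j / N := by
    intro j
    by_cases hj : 0 < j ∧ j < N
    · obtain ⟨a, ha⟩ := ((tendsto_cdf_atBot (μ : Measure ℝ)).eventually_lt_const
        (u := (j : ℝ) / N) (by have := hj.1; positivity)).exists
      obtain ⟨b, hb⟩ := ((tendsto_cdf_atTop (μ : Measure ℝ)).eventually_const_lt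
        (u := (j : ℝ) / N) (by rw [div_lt_one hN0]; exact_mod_cast hj.2)).exists
      obtain ⟨q, hq⟩ := mem_range_of_exists_le_of_exists_ge hcont ⟨a, ha.le⟩ ⟨b, hb.le⟩
      exact ⟨q, fun _ _ => hq⟩
    · exact ⟨0, fun h1 h2 => absurd ⟨h1, h2⟩ hj⟩
  choose q hq using hq
  have hev : ∀ᶠ k in atTop, ∀ j ∈ Finset.range N,
      |(ν k : Measure ℝ).real (Set.Iic (q j)) - F (q j)| < ε / 2 - 1 / N := by
    rw [Filter.eventually_all_finset]
    intro j _
    have := (Metric.tendsto_nhds.1 (hpt (q j))) (ε / 2 - 1 / N) (by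
      rw [gt_iff_lt, sub_pos, div_lt_div_iff₀ hN0 two_pos]
      rw [div_lt_iff₀ hε] at hN
      linarith)
    simpa [Real.dist_eq] using this
  obtain ⟨K, hK⟩ := eventually_atTop.1 hev
  refine ⟨K, fun k hk => ?_⟩
  have hj := fun j (h : j < N) => abs_lt.1 (hK k hk j (Finset.mem_range.2 h))
  set a := F (x k) with ha
  have ha0 : 0 ≤ a := cdf_nonneg _ _
  have ha1 : a ≤ 1 := cdf_le_one _ _
  have hNε : 1 / (N : ℝ) < ε / 2 := by
    rw [div_lt_div_iff₀ hN0 two_pos]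
    rw [div_lt_iff₀ hε] at hN
    linarith
  rw [Real.dist_eq, sub_zero, abs_lt]
  constructor
  · rcases Nat.eq_zero_or_eq_succ_pred ⌈N * a⌉₊ with h0 | h1
    · have : a ≤ 0 := by
        rw [Nat.ceil_eq_zero] at h0
        exact nonpos_of_mul_nonpos_right h0 hN0
      have := measureReal_nonneg (μ := (ν k : Measure ℝ)) (s := A k)
      linarith
    -- The last grid level strictly below `a`: `j < N a ≤ j + 1`. Strictness gives `q j < x k`,
    -- hence `Iic (q j) ⊆ Iio (x k) ⊆ A k`.
    · set j := ⌈N * a⌉₊.pred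
      have hle : N * a ≤ j + 1 := by
        have := Nat.le_ceil (N * a)
        rw [h1] at this
        exact_mod_cast this
      have hlt : (j : ℝ) < N * a := Nat.lt_ceil.1 (by rw [h1]; exact Nat.lt_succ_self _)
      have hle' : a ≤ j / N + 1 / N := by
        rw [← add_div, le_div_iff₀ hN0]; linarith
      rcases Nat.eq_zero_or_pos j with hj0 | hj0
      · have := measureReal_nonneg (μ := (ν k : Measure ℝ)) (s := A k)
        simp only [hj0, Nat.cast_zero, zero_div, zero_add] at hle'
        linarith
      · have hjN : j < N := by
          have : (j : ℝ) < N := hlt.trans_le (mul_le_of_le_one_right hN0.le ha1)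
          exact_mod_cast this
        have hF := hq j hj0 hjN
        have hlt' : F (q j) < F (x k) := by
          rw [hF, div_lt_iff₀ hN0]; linarith
        have hqx : q j < x k := F.mono.reflect_lt hlt'
        have hm : (ν k : Measure ℝ).real (Set.Iic (q j)) ≤ (ν k : Measure ℝ).real (A k) :=
          measureReal_mono ((Set.Iic_subset_Iio.2 hqx).trans (hA k))
        have := (hj j hjN).1
        linarith
  -- The first grid level strictly above `a`.
  · set j := ⌊N * a⌋₊ + 1
    have hlt : N * a < j := by exact_mod_cast Nat.lt_floor_add_one (N * a)
    have hle : (j : ℝ) ≤ N * a + 1 := by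
      have := Nat.floor_le (a := N * a) (by positivity)
      push_cast [j]; linarith
    have hle' : j / N ≤ a + 1 / N := by
      rw [div_le_iff₀ hN0, add_mul, one_div, inv_mul_cancel₀ hN0.ne']; linarith
    by_cases hjN : j < N
    · have hF := hq j (Nat.succ_pos _) hjN
      have hlt' : F (x k) < F (q j) := by
        rw [hF, lt_div_iff₀ hN0]; linarith
      have hqx : x k < q j := F.mono.reflect_lt hlt'
      have hm : (ν k : Measure ℝ).real (A k) ≤ (ν k : Measure ℝ).real (Set.Iic (q j)) :=
        measureReal_mono ((hA' k).trans (Set.Iic_subset_Iic.2 hqx.le))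
      have := (hj j hjN).2
      linarith
    · have : (1 : ℝ) ≤ j / N := by
        rw [one_le_div hN0]; exact_mod_cast not_lt.1 hjN
      have := measureReal_le_one (μ := (ν k : Measure ℝ)) (s := A k)
      linarith

/-! ### Moments of quadratic polynomials of a Gaussian variable -/

section GaussianMoments

lemma memLp_id_gaussianReal_nat (k : ℕ) : MemLp id (k : ENNReal) (gaussianReal 0 1) :=
  memLp_id_gaussianReal' _ (ENNReal.natCast_ne_top k)

lemma integrable_pow_gaussianReal (k : ℕ) :
    Integrable (fun x : ℝ => x ^ k) (gaussianReal 0 1) := by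
  have := (memLp_id_gaussianReal_nat k).integrable_norm_pow'
  refine (integrable_norm_iff (by fun_prop)).1 ?_
  simpa using this

lemma integral_pow_gaussianReal (k : ℕ) :
    ∫ x, x ^ k ∂(gaussianReal 0 1) = iteratedDeriv k (fun t : ℝ => Real.exp (t ^ 2 / 2)) 0 := by
  have h := iteratedDeriv_mgf_zero (X := id) (μ := gaussianReal 0 1) (by simp) k
  rw [mgf_id_gaussianReal] at h
  simpa using h.symm

/-- Differentiation acts on the prefactor by `f ↦ f' + t f`, which reduces the derivatives of the
moment generating function to a recursion on polynomials. -/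
lemma deriv_mul_exp_sq_div_two {f f' : ℝ → ℝ} (hf : ∀ t, HasDerivAt f (f' t) t) :
    deriv (fun t : ℝ => f t * Real.exp (t ^ 2 / 2))
      = fun t => (f' t + t * f t) * Real.exp (t ^ 2 / 2) := by
  ext t
  have h1 : HasDerivAt (fun t : ℝ => t ^ 2 / 2) t t := by
    have := (hasDerivAt_pow 2 t).div_const 2
    simpa using this
  have h2 := ((hf t).mul h1.exp).deriv
  rw [show (fun t : ℝ => f t * Real.exp (t ^ 2 / 2)) = f * fun t => Real.exp (t ^ 2 / 2) from rfl,
    h2]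
  ring

lemma integral_pow_gaussianReal_le_four :
    ∫ x, x ∂(gaussianReal 0 1) = 0 ∧ ∫ x, x ^ 2 ∂(gaussianReal 0 1) = 1 ∧
      ∫ x, x ^ 3 ∂(gaussianReal 0 1) = 0 ∧ ∫ x, x ^ 4 ∂(gaussianReal 0 1) = 3 := by
  have d1 : deriv (fun t : ℝ => Real.exp (t ^ 2 / 2)) = fun t => t * Real.exp (t ^ 2 / 2) := by
    have := deriv_mul_exp_sq_div_two (f := fun _ => 1) (f' := fun _ => 0)
      (fun t => hasDerivAt_const t 1)
    simpa using this
  have d2 : deriv (fun t : ℝ => t * Real.exp (t ^ 2 / 2))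
      = fun t => (1 + t ^ 2) * Real.exp (t ^ 2 / 2) := by
    rw [deriv_mul_exp_sq_div_two (f := fun t => t) (f' := fun _ => 1) (fun t => hasDerivAt_id t)]
    ext t; ring
  have d3 : deriv (fun t : ℝ => (1 + t ^ 2) * Real.exp (t ^ 2 / 2))
      = fun t => (3 * t + t ^ 3) * Real.exp (t ^ 2 / 2) := by
    rw [deriv_mul_exp_sq_div_two (f := fun t => 1 + t ^ 2) (f' := fun t => 2 * t) (fun t => by
      simpa using (hasDerivAt_pow 2 t).const_add 1)]
    ext t; ring
  have d4 : deriv (fun t : ℝ => (3 * t + t ^ 3) * Real.exp (t ^ 2 / 2))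
      = fun t => (3 + 6 * t ^ 2 + t ^ 4) * Real.exp (t ^ 2 / 2) := by
    rw [deriv_mul_exp_sq_div_two (f := fun t => 3 * t + t ^ 3) (f' := fun t => 3 + 3 * t ^ 2)
      (fun t => by
        have := ((hasDerivAt_id t).const_mul 3).add (hasDerivAt_pow 3 t)
        convert! this using 1
        simp)]
    ext t; ring
  refine ⟨integral_id_gaussianReal, ?_, ?_, ?_⟩ <;> rw [integral_pow_gaussianReal] <;>
    simp [iteratedDeriv_succ, iteratedDeriv_zero, d1, d2, d3, d4]

/-- The centred quadratic polynomial `a (z² - 1) + 2 b z` of a standard Gaussian variable. -/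
def hermiteQuadratic (a b z : ℝ) : ℝ := a * (z ^ 2 - 1) + 2 * b * z

lemma measurable_hermiteQuadratic (a b : ℝ) : Measurable (hermiteQuadratic a b) := by
  unfold hermiteQuadratic; fun_prop

lemma measurable_sum_hermiteQuadratic {ι : Type*} [Fintype ι] (a b : ι → ℝ) :
    Measurable fun z : ι → ℝ => ∑ j, hermiteQuadratic (a j) (b j) (z j) :=
  Finset.measurable_fun_sum _ fun j _ =>
    (measurable_hermiteQuadratic (a j) (b j)).comp (measurable_pi_apply j)

lemma integral_hermiteQuadratic (a b : ℝ) :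
    ∫ z, hermiteQuadratic a b z ∂(gaussianReal 0 1) = 0 := by
  obtain ⟨m1, m2, -, -⟩ := integral_pow_gaussianReal_le_four
  have i1 := integrable_pow_gaussianReal 1
  have i2 := integrable_pow_gaussianReal 2
  simp only [pow_one] at i1
  unfold hermiteQuadratic
  rw [integral_add (by exact (i2.sub (integrable_const _)).const_mul _) (i1.const_mul _),
    integral_const_mul, integral_const_mul, integral_sub i2 (integrable_const _), m1, m2]
  simp

lemma integral_hermiteQuadratic_sq (a b : ℝ) :
    ∫ z, hermiteQuadratic a b z ^ 2 ∂(gaussianReal 0 1) = 2 * a ^ 2 + 4 * b ^ 2 := by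
  obtain ⟨m1, m2, m3, m4⟩ := integral_pow_gaussianReal_le_four
  have i1 := integrable_pow_gaussianReal 1
  have i2 := integrable_pow_gaussianReal 2
  have i3 := integrable_pow_gaussianReal 3
  have i4 := integrable_pow_gaussianReal 4
  simp only [pow_one] at i1
  have e : ∀ z, hermiteQuadratic a b z ^ 2 = a ^ 2 * z ^ 4 + 4 * a * b * z ^ 3
      + (4 * b ^ 2 - 2 * a ^ 2) * z ^ 2 + (-4 * a * b) * z + a ^ 2 := fun z => by
    unfold hermiteQuadratic; ring
  simp_rw [e]
  have j1 := i1.const_mul (-4 * a * b)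
  rw [integral_add (by exact .add (by fun_prop) j1) (integrable_const _), integral_add (by fun_prop) j1,
    integral_add (by fun_prop) (by fun_prop), integral_add (by fun_prop) (by fun_prop)]
  rw [integral_const_mul, integral_const_mul, integral_const_mul, integral_const_mul, m1, m2, m3, m4]
  simp
  ring

lemma exists_integral_hermiteQuadratic_pow_four_le :
    ∃ K : ℝ, 0 ≤ K ∧ ∀ a b : ℝ,
      ∫ z, hermiteQuadratic a b z ^ 4 ∂(gaussianReal 0 1) ≤ K * (a ^ 4 + b ^ 4) := by
  have i4 := integrable_pow_gaussianReal 4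
  have i8 : Integrable (fun z : ℝ => (z ^ 2 - 1) ^ 4) (gaussianReal 0 1) := by
    have e : ∀ z : ℝ, (z ^ 2 - 1) ^ 4
        = z ^ 8 - 4 * z ^ 6 + 6 * z ^ 4 - 4 * z ^ 2 + 1 := fun z => by ring
    have i2 := integrable_pow_gaussianReal 2
    have i6 := integrable_pow_gaussianReal 6
    have i8 := integrable_pow_gaussianReal 8
    simp_rw [e]
    fun_prop
  -- From `(u + w)⁴ ≤ 8 (u⁴ + w⁴)` with `w = 2 b z`, whence `128 = 8 * 2⁴`. Adding the two
  -- nonnegative cross terms yields one constant for both `a⁴` and `b⁴`.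
  refine ⟨∫ z, (8 * (z ^ 2 - 1) ^ 4 + 128 * z ^ 4) ∂(gaussianReal 0 1),
    integral_nonneg fun z => by positivity, fun a b => ?_⟩
  rw [mul_comm, ← integral_const_mul]
  refine integral_mono_of_nonneg (.of_forall fun z => by positivity) (by fun_prop)
    (.of_forall fun z => ?_)
  have h : ∀ u w : ℝ, (u + w) ^ 4 ≤ 8 * (u ^ 4 + w ^ 4) := fun u w => by
    nlinarith [sq_nonneg (u ^ 2 - w ^ 2), sq_nonneg ((u - w) ^ 2), sq_nonneg (u ^ 2 - u * w),
      sq_nonneg (w ^ 2 - u * w), sq_nonneg (u ^ 2 + w ^ 2 - 2 * u * w)]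
  refine (h _ _).trans ?_
  have h1 : 0 ≤ a ^ 4 * (128 * z ^ 4) := by positivity
  have h2 : 0 ≤ b ^ 4 * (8 * (z ^ 2 - 1) ^ 4) := by positivity
  simp only [mul_pow]
  linarith

lemma memLp_hermiteQuadratic (a b : ℝ) : MemLp (hermiteQuadratic a b) 4 (gaussianReal 0 1) := by
  have h1 : MemLp (fun z : ℝ => z) 4 (gaussianReal 0 1) := memLp_id_gaussianReal_nat 4
  have h2 : MemLp (fun z : ℝ => z ^ 2) 4 (gaussianReal 0 1) := by
    have h8 := integrable_pow_gaussianReal 8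
    rw [← integrable_norm_rpow_iff (by fun_prop) (by norm_num) (by norm_num)]
    refine h8.congr (.of_forall fun z => ?_)
    norm_num
    ring
  exact ((h2.sub (memLp_const 1)).const_mul a).add (h1.const_mul (2 * b))

end GaussianMoments

/-! ### Central limit theorem for Gaussian quadratic polynomials -/

/-- Central limit theorem for the quadratic polynomials `∑ aⱼ (zⱼ² - 1) + 2 bⱼ zⱼ` of standard
Gaussian vectors. -/
theorem tendsto_hermiteQuadratic_sum {p : ℕ → ℕ} (a b : (k : ℕ) → Fin (p k) → ℝ) (v : ℕ → ℝ)
    (hv : ∀ k, v k = ∑ j, (2 * a k j ^ 2 + 4 * b k j ^ 2)) (hpos : ∀ᶠ k in atTop, 0 < v k)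
    (hlyap : Tendsto (fun k => (∑ j, (a k j ^ 4 + b k j ^ 4)) / v k ^ 2) atTop (𝓝 0))
    (ν : ℕ → ProbabilityMeasure ℝ)
    (hν : ∀ k, (ν k : Measure ℝ) = (Measure.pi fun _ : Fin (p k) => gaussianReal 0 1).map
      (fun z => (∑ j, hermiteQuadratic (a k j) (b k j) (z j)) / √(v k)))
    (ν₀ : ProbabilityMeasure ℝ) (hν₀ : (ν₀ : Measure ℝ) = gaussianReal 0 1) :
    Tendsto ν atTop (𝓝 ν₀) := by
  set g : (k : ℕ) → Fin (p k) → ℝ → ℝ :=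
    fun k j z => hermiteQuadratic (a k j) (b k j) z / √(v k) with hg
  have hgm : ∀ k j, Measurable (g k j) := fun k j => (measurable_hermiteQuadratic _ _).div_const _
  let μ : (k : ℕ) → Fin (p k) → Measure ℝ := fun k j => (gaussianReal 0 1).map (g k j)
  have hμ : ∀ k j, IsProbabilityMeasure (μ k j) := fun k j =>
    Measure.isProbabilityMeasure_map (hgm k j).aemeasurable
  have hint : ∀ k j (n : ℕ), ∫ x, x ^ n ∂(μ k j)
      = (∫ z, hermiteQuadratic (a k j) (b k j) z ^ n ∂(gaussianReal 0 1)) / √(v k) ^ n := by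
    intro k j n
    rw [integral_map (hgm k j).aemeasurable (by fun_prop), ← integral_div]
    simp [hg, div_pow]
  have hv0 : ∀ k, 0 ≤ v k := fun k => by
    rw [hv]; exact Finset.sum_nonneg fun j _ => by positivity
  obtain ⟨K, hK0, hK⟩ := exists_integral_hermiteQuadratic_pow_four_le
  refine tendsto_sum_pi_gaussianReal_of_lyapunov μ (fun k j => ?_) (fun k j => ?_) ?_ ?_ ν
    (fun k => ?_) ν₀ hν₀
  · rw [memLp_map_measure_iff (by fun_prop) (hgm k j).aemeasurable]
    exact ((memLp_hermiteQuadratic (a k j) (b k j)).mul_const (√(v k))⁻¹)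
  · have := hint k j 1
    simpa [integral_hermiteQuadratic] using this
  · filter_upwards [hpos] with k hk
    simp_rw [hint, integral_hermiteQuadratic_sq, Real.sq_sqrt (hv0 k)]
    rw [← Finset.sum_div, ← hv, div_self hk.ne']
  · refine squeeze_zero (fun k => Finset.sum_nonneg fun j _ => integral_nonneg fun x => by positivity)
      (fun k => ?_) (by simpa using hlyap.const_mul K)
    have e : √(v k) ^ 4 = v k ^ 2 := by
      rw [show 4 = 2 * 2 by norm_num, pow_mul, Real.sq_sqrt (hv0 k)]
    simp_rw [hint, e]
    rw [← Finset.sum_div, ← mul_div_assoc, Finset.mul_sum]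
    gcongr with j _
    exact hK _ _
  · rw [hν]
    have hpi : Measure.pi (μ k) = (Measure.pi fun _ : Fin (p k) => gaussianReal 0 1).map
        (fun z j => g k j (z j)) :=
      (Measure.pi_map_pi (fun j => (hgm k j).aemeasurable)).symm
    have hgk : Measurable fun (z : Fin (p k) → ℝ) j => g k j (z j) :=
      measurable_pi_lambda _ fun j => (hgm k j).comp (measurable_pi_apply j)
    rw [hpi, Measure.map_map (by fun_prop) hgk]
    congr 1
    ext z
    simp [hg, Finset.sum_div]

/-! ### Quadratic forms, the ridge estimator and spectral decomposition -/

namespace RQDA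

section Matrices

variable {p : ℕ}

lemma act_mul (A B : Matrix (Fin p) (Fin p) ℝ) (v : EuclideanSpace ℝ (Fin p)) :
    act (A * B) v = act A (act B v) := by
  simp [act]

lemma act_sub_left (A B : Matrix (Fin p) (Fin p) ℝ) (v : EuclideanSpace ℝ (Fin p)) :
    act (A - B) v = act A v - act B v := by
  simp [act]

lemma act_add (A : Matrix (Fin p) (Fin p) ℝ) (v w : EuclideanSpace ℝ (Fin p)) :
    act A (v + w) = act A v + act A w := by
  simp [act]

lemma inner_act_left {A : Matrix (Fin p) (Fin p) ℝ} (hA : A.IsHermitian)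
    (v w : EuclideanSpace ℝ (Fin p)) : inner ℝ (act A v) w = inner ℝ v (act A w) := by
  have h : IsSelfAdjoint (Matrix.toEuclideanCLM (𝕜 := ℝ) A) :=
    IsSelfAdjoint.map (f := Matrix.toEuclideanCLM (n := Fin p) (𝕜 := ℝ)) hA
  unfold act
  rw [← ContinuousLinearMap.adjoint_inner_left, h.adjoint_eq]

lemma quad_nonneg {A : Matrix (Fin p) (Fin p) ℝ} (hA : A.PosSemidef)
    (v : EuclideanSpace ℝ (Fin p)) : 0 ≤ quad A v := by
  unfold quad act
  rw [inner_toEuclideanCLM]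
  simpa using hA.dotProduct_mulVec_nonneg v.ofLp

lemma quad_le_specNorm_mul (A : Matrix (Fin p) (Fin p) ℝ) (v : EuclideanSpace ℝ (Fin p)) :
    quad A v ≤ specNorm A * ‖v‖ ^ 2 := by
  refine (real_inner_le_norm _ _).trans ?_
  have := (Matrix.toEuclideanCLM (𝕜 := ℝ) A).le_opNorm v
  have h := mul_le_mul_of_nonneg_left this (norm_nonneg v)
  unfold act specNorm
  linarith

lemma quad_add {A : Matrix (Fin p) (Fin p) ℝ} (hA : A.IsHermitian)
    (v w : EuclideanSpace ℝ (Fin p)) :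
    quad A (v + w) = quad A v + 2 * inner ℝ w (act A v) + quad A w := by
  unfold quad
  rw [act_add, inner_add_left, inner_add_right, inner_add_right, ← inner_act_left hA v w,
    real_inner_comm w]
  ring

lemma continuous_quad (A : Matrix (Fin p) (Fin p) ℝ) : Continuous (quad A) := by
  unfold quad act
  fun_prop

lemma continuous_act (A : Matrix (Fin p) (Fin p) ℝ) : Continuous (act A) := by
  unfold act
  fun_prop

lemma isHermitian_sqrt (A : Matrix (Fin p) (Fin p) ℝ) : (CFC.sqrt A).IsHermitian :=
  (CFC.sqrt_nonneg A).isSelfAdjoint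

lemma norm_act_sqrt_sq_le {A : Matrix (Fin p) (Fin p) ℝ} (hA : A.PosSemidef)
    (v : EuclideanSpace ℝ (Fin p)) : ‖act (CFC.sqrt A) v‖ ^ 2 ≤ specNorm A * ‖v‖ ^ 2 := by
  rw [← real_inner_self_eq_norm_sq, inner_act_left (isHermitian_sqrt A), ← act_mul,
    CFC.sqrt_mul_sqrt_self _ hA.nonneg]
  exact quad_le_specNorm_mul A v

lemma posSemidef_sampleCov {n : ℕ} (x : Fin n → EuclideanSpace ℝ (Fin p)) :
    (sampleCov x).PosSemidef := by
  unfold sampleCov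
  -- For `n = 0` the scalar is `-1` but the sum is empty; for `n = 1` it is `1 / 0 = 0`.
  rcases Nat.eq_zero_or_pos n with rfl | hn
  · simpa using Matrix.PosSemidef.zero
  · have hn' : (1 : ℝ) ≤ n := by exact_mod_cast hn
    refine Matrix.PosSemidef.smul (Matrix.posSemidef_sum _ fun l _ => ?_)
      (one_div_nonneg.2 (by linarith))
    simpa using Matrix.posSemidef_vecMulVec_self_star (x l - sampleMean x).ofLp

section Ridge

variable {n : ℕ} {γ : ℝ} (hγ : 0 < γ) (x : Fin n → EuclideanSpace ℝ (Fin p))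
include hγ

lemma posDef_one_add_smul_sampleCov : (1 + γ • sampleCov x).PosDef :=
  Matrix.PosDef.one.add_posSemidef ((posSemidef_sampleCov x).smul hγ.le)

lemma isHermitian_ridge : (ridge γ x).IsHermitian :=
  (posDef_one_add_smul_sampleCov hγ x).isHermitian.inv

/-- This is `0 ≤ H ≤ I`. With `A = γ Σ̂ ≥ 0` and `u = H w` one has `w = u + A u`, so `wᵀ H w = ‖u‖²
+ uᵀ A u`, while `‖w‖² = ‖u‖² + 2 uᵀ A u + ‖A u‖²`. -/
lemma quad_ridge_mem_Icc (w : EuclideanSpace ℝ (Fin p)) :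
    quad (ridge γ x) w ∈ Set.Icc 0 (‖w‖ ^ 2) := by
  have hdet := (Matrix.isUnit_iff_isUnit_det _).1 (posDef_one_add_smul_sampleCov hγ x).isUnit
  have hpos : 0 ≤ quad (γ • sampleCov x) (act (ridge γ x) w) :=
    quad_nonneg ((posSemidef_sampleCov x).smul hγ.le) _
  set u := act (ridge γ x) w with hu
  have hw : w = u + act (γ • sampleCov x) u := by
    have h1 : act (1 + γ • sampleCov x) u = w := by
      rw [hu, ← act_mul, ridge, Matrix.mul_nonsing_inv _ hdet]
      simp [act]
    rw [← h1]
    simp [act]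
  have h1 : quad (ridge γ x) w = ‖u‖ ^ 2 + quad (γ • sampleCov x) u := by
    unfold quad
    rw [← hu]
    nth_rw 1 [hw]
    rw [inner_add_left, real_inner_self_eq_norm_sq, real_inner_comm]
  have h2 : ‖w‖ ^ 2 = ‖u‖ ^ 2 + 2 * quad (γ • sampleCov x) u + ‖act (γ • sampleCov x) u‖ ^ 2 := by
    conv_lhs => rw [hw]
    rw [norm_add_sq_real]
    rfl
  rw [h1, h2]
  constructor <;> nlinarith [sq_nonneg ‖u‖, sq_nonneg ‖act (γ • sampleCov x) u‖]

end Ridge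

lemma trace_sq_eq_sum_eigenvalues_sq {B : Matrix (Fin p) (Fin p) ℝ} (hB : B.IsHermitian) :
    (B ^ 2).trace = ∑ j, hB.eigenvalues j ^ 2 := by
  conv_lhs => rw [hB.spectral_theorem]
  rw [← map_pow, Unitary.conjStarAlgAut_apply, Matrix.trace_mul_cycle, Unitary.coe_star_mul_self,
    one_mul, Matrix.diagonal_pow, Matrix.trace_diagonal]
  simp

lemma act_eigenvectorBasis {B : Matrix (Fin p) (Fin p) ℝ} (hB : B.IsHermitian) (j : Fin p) :
    act B (hB.eigenvectorBasis j) = hB.eigenvalues j • hB.eigenvectorBasis j := by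
  ext i
  exact congrFun (hB.mulVec_eigenvectorBasis j) i

lemma quad_sum_smul_eigenvectorBasis {B : Matrix (Fin p) (Fin p) ℝ} (hB : B.IsHermitian)
    (z : Fin p → ℝ) :
    quad B (∑ j, z j • hB.eigenvectorBasis j) = ∑ j, hB.eigenvalues j * z j ^ 2 := by
  have h : act B (∑ j, z j • hB.eigenvectorBasis j)
      = ∑ j, (hB.eigenvalues j * z j) • hB.eigenvectorBasis j := by
    have : act B (∑ j, z j • hB.eigenvectorBasis j)
        = ∑ j, z j • act B (hB.eigenvectorBasis j) := by simp [act]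
    rw [this]
    refine Finset.sum_congr rfl fun j _ => ?_
    rw [act_eigenvectorBasis, smul_smul, mul_comm]
  rw [quad, h, hB.eigenvectorBasis.orthonormal.inner_sum]
  refine Finset.sum_congr rfl fun j _ => ?_
  simp
  ring

end Matrices

/-! ### The discriminant in the eigenbasis of `B_i` -/

section Discriminant

variable {p : ℕ} {n : Fin 2 → ℕ} {γ : ℝ} (hγ : 0 < γ) (π : Fin 2 → ℝ)
  (m : Fin 2 → EuclideanSpace ℝ (Fin p)) {S : Fin 2 → Matrix (Fin p) (Fin p) ℝ}
  (hS : ∀ i, (S i).PosSemidef)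
  (x : (i : Fin 2) → Fin (n i) → EuclideanSpace ℝ (Fin p)) (i : Fin 2)

include hγ

lemma isHermitian_matB : (matB γ S x i).IsHermitian := by
  have h := (isHermitian_ridge hγ (x 1)).sub (isHermitian_ridge hγ (x 0))
  have hs := isHermitian_sqrt (S i)
  unfold matB
  have := Matrix.isHermitian_mul_mul_conjTranspose (CFC.sqrt (S i)) h
  rwa [hs.eq] at this

/-- In the expansion of the two quadratic forms around `m i`, the quadratic terms give `B_i`, the
cross terms `r_i` and the constants `-ξ_i`. -/
lemma discriminant_eq (z : EuclideanSpace ℝ (Fin p)) :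
    discriminant γ π x (m i + act (CFC.sqrt (S i)) z)
      = (quad (matB γ S x i) z + 2 * inner ℝ (vecR γ m S x i) z - xi γ π m x i) / 2 := by
  have hs := isHermitian_sqrt (S i)
  set w := act (CFC.sqrt (S i)) z with hw
  have hB : quad (matB γ S x i) z = quad (ridge γ (x 1)) w - quad (ridge γ (x 0)) w := by
    unfold quad matB
    rw [act_mul, act_mul, ← inner_act_left hs, act_sub_left, inner_sub_right]
  have hr : inner ℝ (vecR γ m S x i) z = inner ℝ w (act (ridge γ (x 1)) (m i - sampleMean (x 1)))
      - inner ℝ w (act (ridge γ (x 0)) (m i - sampleMean (x 0))) := by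
    unfold vecR
    rw [inner_act_left hs, real_inner_comm, ← hw, inner_sub_right]
  unfold discriminant xi
  rw [add_sub_right_comm (m i) w, add_sub_right_comm (m i) w, quad_add (isHermitian_ridge hγ (x 0)),
    quad_add (isHermitian_ridge hγ (x 1)), hB, hr]
  ring

include hS in
lemma abs_eigenvalues_matB_le (j : Fin p) :
    |(isHermitian_matB (S := S) hγ x i).eigenvalues j| ≤ specNorm (S i) := by
  set hB := isHermitian_matB (S := S) hγ x i
  set v := hB.eigenvectorBasis j with hv
  have hv1 : ‖v‖ = 1 := hB.eigenvectorBasis.orthonormal.1 j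
  have hs := isHermitian_sqrt (S i)
  set w := act (CFC.sqrt (S i)) v with hw
  -- The eigenvalue is a difference of two numbers in `[0, ‖w‖²]`, so no factor two is lost.
  have e : hB.eigenvalues j = quad (ridge γ (x 1)) w - quad (ridge γ (x 0)) w := by
    have h1 : quad (matB γ S x i) v = hB.eigenvalues j := by
      rw [quad, hv, act_eigenvectorBasis, ← hv, inner_smul_right, real_inner_self_eq_norm_sq, hv1]
      simp
    rw [← h1]
    unfold quad matB
    rw [act_mul, act_mul, ← inner_act_left hs, act_sub_left, inner_sub_right]
  have hw1 : ‖w‖ ^ 2 ≤ specNorm (S i) := by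
    simpa [hv1] using norm_act_sqrt_sq_le (hS i) v
  have h0 := quad_ridge_mem_Icc hγ (x 0) w
  have h1 := quad_ridge_mem_Icc hγ (x 1) w
  rw [e, abs_le]
  constructor <;> linarith [h0.1, h0.2, h1.1, h1.2]

lemma sum_eigenvalues_vecR_eq_totalVar :
    totalVar γ m S x i = ∑ j, (2 * (isHermitian_matB (S := S) hγ x i).eigenvalues j ^ 2
      + 4 * inner ℝ (vecR γ m S x i)
        ((isHermitian_matB (S := S) hγ x i).eigenvectorBasis j) ^ 2) := by
  rw [totalVar, trace_sq_eq_sum_eigenvalues_sq (isHermitian_matB (S := S) hγ x i),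
    Finset.sum_add_distrib, ← Finset.mul_sum, ← Finset.mul_sum,
    OrthonormalBasis.sum_sq_inner_left]

include hS in
/-- The fourth moment Lyapunov sum is controlled by the ratio of the statement. -/
lemma sum_pow_four_div_le_lyapunovRatio :
    (∑ j, ((isHermitian_matB (S := S) hγ x i).eigenvalues j ^ 4
      + inner ℝ (vecR γ m S x i)
        ((isHermitian_matB (S := S) hγ x i).eigenvectorBasis j) ^ 4)) / totalVar γ m S x i ^ 2
      ≤ (1 + specNorm (S i) ^ 2) * lyapunovRatio γ m S x i := by
  set hB := isHermitian_matB (S := S) hγ x i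
  set C := specNorm (S i)
  set r := vecR γ m S x i
  -- Two powers of each eigenvalue are traded for `C²`; this leaves `tr B²`, as in the numerator of
  -- `lyapunovRatio`, instead of `tr B⁴`.
  have h1 : ∑ j, hB.eigenvalues j ^ 4 ≤ C ^ 2 * (matB γ S x i ^ 2).trace := by
    rw [trace_sq_eq_sum_eigenvalues_sq hB, Finset.mul_sum]
    refine Finset.sum_le_sum fun j _ => ?_
    have h := abs_eigenvalues_matB_le hγ hS x i j
    have h2 : hB.eigenvalues j ^ 2 ≤ C ^ 2 := sq_le_sq' (by linarith [(abs_le.1 h).1]) (abs_le.1 h).2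
    nlinarith [sq_nonneg (hB.eigenvalues j)]
  have h2 : ∑ j, inner ℝ r (hB.eigenvectorBasis j) ^ 4 ≤ ‖r‖ ^ 4 := by
    have e : ‖r‖ ^ 4 = ∑ j, ‖r‖ ^ 2 * inner ℝ r (hB.eigenvectorBasis j) ^ 2 := by
      rw [← Finset.mul_sum, OrthonormalBasis.sum_sq_inner_left]; ring
    rw [e]
    refine Finset.sum_le_sum fun j _ => ?_
    have h := abs_real_inner_le_norm r (hB.eigenvectorBasis j)
    rw [hB.eigenvectorBasis.orthonormal.1 j, mul_one] at h
    have h2 : inner ℝ r (hB.eigenvectorBasis j) ^ 2 ≤ ‖r‖ ^ 2 :=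
      sq_le_sq' (by linarith [(abs_le.1 h).1]) (abs_le.1 h).2
    nlinarith [sq_nonneg (inner ℝ r (hB.eigenvectorBasis j))]
  have ht : 0 ≤ (matB γ S x i ^ 2).trace := by
    rw [trace_sq_eq_sum_eigenvalues_sq hB]; positivity
  rw [lyapunovRatio, ← mul_div_assoc, Finset.sum_add_distrib]
  refine div_le_div_of_nonneg_right ?_ (sq_nonneg _)
  have a1 : 0 ≤ (matB γ S x i ^ 2).trace * ‖r‖ ^ 2 := by positivity
  have a2 : 0 ≤ C ^ 2 * ((matB γ S x i ^ 2).trace * ‖r‖ ^ 2) := by positivity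
  have a3 : 0 ≤ C ^ 2 * (matB γ S x i ^ 2).trace := by positivity
  have a4 : 0 ≤ C ^ 2 * ‖r‖ ^ 4 := by positivity
  have a5 : 0 ≤ ‖r‖ ^ 4 := by positivity
  nlinarith

/-- Law of the standardised quadratic form `zᵀ B z + 2 rᵀ z`, `z` standard Gaussian. -/
noncomputable def standardizedLaw : Measure ℝ :=
  (Measure.pi fun _ : Fin p => gaussianReal 0 1).map fun z =>
    (∑ j, hermiteQuadratic ((isHermitian_matB (S := S) hγ x i).eigenvalues j)
      (inner ℝ (vecR γ m S x i) ((isHermitian_matB (S := S) hγ x i).eigenvectorBasis j)) (z j))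
      / √(totalVar γ m S x i)

/-- By rotation invariance the coordinates of `z` in the eigenbasis of `B_i` are again independent
standard Gaussians. Moving `tr B_i` into the threshold centres the squares, and `hv` allows division
by the standard deviation. -/
lemma condError_eq_standardizedLaw (hv : 0 < totalVar γ m S x i) :
    condError γ π m S x i = (standardizedLaw (S := S) hγ m x i).real
      {t | (-1 : ℝ) ^ (i : ℕ) * (t - (xi γ π m x i - (matB γ S x i).trace)
        / √(totalVar γ m S x i)) < 0} := by
  set hB := isHermitian_matB (S := S) hγ x i
  have hmeas : MeasurableSet {y | (-1 : ℝ) ^ (i : ℕ) * discriminant γ π x y < 0} := by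
    refine measurableSet_lt ?_ measurable_const
    unfold discriminant
    have h0 := (continuous_quad (ridge γ (x 0))).measurable
    have h1 := (continuous_quad (ridge γ (x 1))).measurable
    fun_prop
  have hact : Measurable fun z => m i + act (CFC.sqrt (S i)) z :=
    ((continuous_act _).measurable).const_add _
  have hlin : Measurable fun z : Fin p → ℝ => ∑ j, z j • hB.eigenvectorBasis j := by fun_prop
  have hset : MeasurableSet {t : ℝ | (-1 : ℝ) ^ (i : ℕ) * (t - (xi γ π m x i
      - (matB γ S x i).trace) / √(totalVar γ m S x i)) < 0} :=
    measurableSet_lt (by fun_prop) measurable_const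
  have hlaw : multivariateGaussian (m i) (S i)
      = (Measure.pi fun _ : Fin p => gaussianReal 0 1).map
        ((fun z => m i + act (CFC.sqrt (S i)) z) ∘ fun z => ∑ j, z j • hB.eigenvectorBasis j) := by
    rw [← Measure.map_map hact hlin, ← stdGaussian_eq_map_pi_orthonormalBasis]
    rfl
  rw [condError, hlaw, map_measureReal_apply (hact.comp hlin) hmeas, standardizedLaw,
    map_measureReal_apply ((measurable_sum_hermiteQuadratic _ _).div_const _) hset]
  congr 1
  ext z
  simp only [Set.mem_preimage, Set.mem_ofPred_eq, Function.comp_apply]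
  rw [discriminant_eq hγ, quad_sum_smul_eigenvectorBasis hB, ← sub_div, mul_div_assoc',
    mul_div_assoc', div_lt_iff₀ two_pos, div_lt_iff₀ (Real.sqrt_pos.2 hv), zero_mul, zero_mul]
  have e : ∑ j, hB.eigenvalues j * z j ^ 2
      + 2 * inner ℝ (vecR γ m S x i) (∑ j, z j • hB.eigenvectorBasis j) - xi γ π m x i
      = ∑ j, hermiteQuadratic (hB.eigenvalues j)
        (inner ℝ (vecR γ m S x i) (hB.eigenvectorBasis j)) (z j)
        - (xi γ π m x i - (matB γ S x i).trace) := by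
    rw [hB.trace_eq_sum_eigenvalues, inner_sum, Finset.mul_sum]
    simp only [hermiteQuadratic, inner_smul_right, RCLike.ofReal_real_eq_id, id]
    rw [Finset.sum_add_distrib]
    simp only [mul_sub, Finset.sum_sub_distrib, mul_one]
    have : ∀ j, 2 * (z j * inner ℝ (vecR γ m S x i) (hB.eigenvectorBasis j))
        = 2 * inner ℝ (vecR γ m S x i) (hB.eigenvectorBasis j) * z j := fun j => by ring
    simp only [this]
    ring
  rw [e]

end Discriminant

end RQDA

/-! ### Symmetry of `Φ` and the limit of the conditional error -/

lemma cdf_gaussianReal_neg (c : ℝ) :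
    cdf (gaussianReal 0 1) (-c) = 1 - cdf (gaussianReal 0 1) c := by
  have hmap : (gaussianReal 0 1).map (fun x => -x) = gaussianReal 0 1 := by
    rw [gaussianReal_map_neg, neg_zero]
  have hna : NullSingletonClass (gaussianReal 0 1) :=
    nullSingletonClass_gaussianReal one_ne_zero
  rw [cdf_eq_real, cdf_eq_real, ← probReal_compl_eq_one_sub measurableSet_Iic, Set.compl_Iic]
  nth_rw 1 [← hmap]
  rw [map_measureReal_apply measurable_neg measurableSet_Iic]
  have : (fun x : ℝ => -x) ⁻¹' Set.Iic (-c) = Set.Ici c := by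
    ext x; simp
  rw [this]
  exact measureReal_congr Ioi_ae_eq_Ici.symm

namespace RQDA

/-- Deterministic form of the result: along any sequence of training samples for which the
Lyapunov ratio vanishes, the conditional error is asymptotically Gaussian. -/
theorem tendsto_condError_sub_cdf {p : ℕ → ℕ} {n : ℕ → Fin 2 → ℕ} {γ : ℝ} (hγ : 0 < γ)
    (π : ℕ → Fin 2 → ℝ) (m : (k : ℕ) → Fin 2 → EuclideanSpace ℝ (Fin (p k)))
    (S : (k : ℕ) → Fin 2 → Matrix (Fin (p k)) (Fin (p k)) ℝ) (hS : ∀ k i, (S k i).PosSemidef)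
    (x : (k : ℕ) → (i : Fin 2) → Fin (n k i) → EuclideanSpace ℝ (Fin (p k))) (i : Fin 2)
    (hcov : (fun k => specNorm (S k i)) =O[atTop] (fun _ => (1 : ℝ)))
    (hpos : ∀ᶠ k in atTop, 0 < totalVar γ (m k) (S k) (x k) i)
    (hlyap : Tendsto (fun k => lyapunovRatio γ (m k) (S k) (x k) i) atTop (𝓝 0)) :
    Tendsto (fun k => condError γ (π k) (m k) (S k) (x k) i
      - cdf (gaussianReal 0 1) ((-1 : ℝ) ^ (i : ℕ) *
        ((xi γ (π k) (m k) (x k) i - (matB γ (S k) (x k) i).trace)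
          / √(totalVar γ (m k) (S k) (x k) i)))) atTop (𝓝 0) := by
  let ν : ℕ → ProbabilityMeasure ℝ := fun k =>
    ⟨standardizedLaw (S := S k) hγ (m k) (x k) i,
      Measure.isProbabilityMeasure_map
        ((measurable_sum_hermiteQuadratic _ _).div_const _).aemeasurable⟩
  let ν₀ : ProbabilityMeasure ℝ := ⟨gaussianReal 0 1, inferInstance⟩
  have hna : NullSingletonClass (ν₀ : Measure ℝ) := nullSingletonClass_gaussianReal one_ne_zero
  have hweak : Tendsto ν atTop (𝓝 ν₀) := by
    refine tendsto_hermiteQuadratic_sum _ _ _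
      (fun k => sum_eigenvalues_vecR_eq_totalVar (S := S k) hγ (m k) (x k) i) hpos ?_ ν
      (fun k => rfl) ν₀ rfl
    obtain ⟨C, hC⟩ := hcov.bound
    refine squeeze_zero' (.of_forall fun k => by positivity) ?_
      (by simpa using (hlyap.norm.const_mul (1 + C ^ 2)))
    filter_upwards [hC] with k hk
    refine (sum_pow_four_div_le_lyapunovRatio hγ (m k) (hS k) (x k) i).trans ?_
    have hk' : specNorm (S k i) ^ 2 ≤ C ^ 2 := by
      rw [norm_one, mul_one] at hk
      exact sq_le_sq' (by linarith [neg_abs_le (specNorm (S k i)), Real.norm_eq_abs (specNorm (S k i))])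
        ((le_abs_self _).trans hk)
    refine (mul_le_mul_of_nonneg_left (le_abs_self _) (by positivity)).trans ?_
    gcongr
  set c : ℕ → ℝ := fun k => (xi γ (π k) (m k) (x k) i - (matB γ (S k) (x k) i).trace)
          / √(totalVar γ (m k) (S k) (x k) i) with hc
  have hsign : (-1 : ℝ) ^ (i : ℕ) = 1 ∨ (-1 : ℝ) ^ (i : ℕ) = -1 := neg_one_pow_eq_or ℝ _
  -- For sign `1` the event is `t < c k`; for sign `-1` it is `t > c k`, the complement of a closed
  -- half-line, and `1 - Φ(c) = Φ(-c)` produces the sign in the limit.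
  rcases hsign with hi | hi
  · refine (tendsto_measureReal_sub_cdf_of_tendsto hweak (fun k => Set.Iio (c k)) c
      (fun k => subset_rfl) (fun k => Set.Iio_subset_Iic_self)).congr' ?_
    filter_upwards [hpos] with k hk
    have hset : {t : ℝ | (-1 : ℝ) ^ (i : ℕ) * (t - c k) < 0} = Set.Iio (c k) := by
      ext t; simp [hi]
    rw [condError_eq_standardizedLaw hγ (π k) (m k) (x k) _ hk]
    change _ = (ν k : Measure ℝ).real {t : ℝ | (-1 : ℝ) ^ (i : ℕ) * (t - c k) < 0}
      - cdf (ν₀ : Measure ℝ) ((-1 : ℝ) ^ (i : ℕ) * c k)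
    rw [hset, hi, one_mul]
  · have h := (tendsto_measureReal_sub_cdf_of_tendsto hweak (fun k => Set.Iic (c k)) c
      (fun k => Set.Iio_subset_Iic_self) (fun k => subset_rfl)).neg
    rw [neg_zero] at h
    refine h.congr' ?_
    filter_upwards [hpos] with k hk
    have hset : {t : ℝ | (-1 : ℝ) ^ (i : ℕ) * (t - c k) < 0} = (Set.Iic (c k))ᶜ := by
      ext t; simp [hi]
    rw [condError_eq_standardizedLaw hγ (π k) (m k) (x k) _ hk]
    change _ = (ν k : Measure ℝ).real {t : ℝ | (-1 : ℝ) ^ (i : ℕ) * (t - c k) < 0}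
      - cdf (gaussianReal 0 1) ((-1 : ℝ) ^ (i : ℕ) * c k)
    rw [hset, hi, neg_one_mul, cdf_gaussianReal_neg, probReal_compl_eq_one_sub measurableSet_Iic]
    change _ = _ - (1 - cdf (ν₀ : Measure ℝ) (c k))
    ring

end RQDA
theorem mainTheorem8
    {Ω : Type*} [MeasurableSpace Ω] (P : Measure Ω) [IsProbabilityMeasure P]
    -- dimension `p k` and class sample sizes `n k i`
    (p : ℕ → ℕ) (n : ℕ → Fin 2 → ℕ)
    -- regularization parameter and priors
    (γ : ℝ) (hγ : 0 < γ)
    (π : ℕ → Fin 2 → ℝ) (hπ_pos : ∀ k i, 0 < π k i) (hπ_sum : ∀ k, π k 0 + π k 1 = 1)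
    -- class means and covariance matrices
    (m : (k : ℕ) → Fin 2 → EuclideanSpace ℝ (Fin (p k)))
    (S : (k : ℕ) → Fin 2 → Matrix (Fin (p k)) (Fin (p k)) ℝ)
    (hS : ∀ k i, (S k i).PosSemidef)
    -- training samples: for each `k`, independent, of law `N(m k i, S k i)` in class `i`
    (X : (k : ℕ) → (i : Fin 2) → Fin (n k i) → Ω → EuclideanSpace ℝ (Fin (p k)))
    (hX_law : ∀ k i l, HasLaw (X k i l) (multivariateGaussian (m k i) (S k i)) P)
    (hX_indep : ∀ k, iIndepFun (fun a : (Σ i : Fin 2, Fin (n k i)) => X k a.1 a.2) P)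
    -- growth regime
    (hp : Tendsto p atTop atTop) (hn : ∀ i, Tendsto (fun k => n k i) atTop atTop)
    (hn_diff : Tendsto (fun k => (n k 0 : ℝ) - (n k 1 : ℝ)) atTop (𝓝 0))
    (c : ℝ) (hc : 0 < c)
    (hpn : Tendsto (fun k => (p k : ℝ) / ((n k 0 : ℝ) + (n k 1 : ℝ))) atTop (𝓝 c))
    (hmean : (fun k => ‖m k 0 - m k 1‖ ^ 2) =O[atTop] (fun k => √(p k : ℝ)))
    (hcov : ∀ i, (fun k => RQDA.specNorm (S k i)) =O[atTop] (fun _ => (1 : ℝ)))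
    (heig : RQDA.EigenvalueSplit p (fun k => S k 0 - S k 1)
      (fun k => (hS k 0).isHermitian.sub (hS k 1).isHermitian))
    -- the additional condition on the (random) quantities `B_i` and `r_i`, almost surely
    (hcond : ∀ i, ∀ᵐ ω ∂P,
      (∀ᶠ k in atTop, 0 < RQDA.totalVar γ (m k) (S k) (fun j l => X k j l ω) i) ∧
      Tendsto (fun k => RQDA.lyapunovRatio γ (m k) (S k) (fun j l => X k j l ω) i)
        atTop (𝓝 0)) :
    ∀ i : Fin 2, ∀ᵐ ω ∂P,
      Tendsto (fun k =>
        RQDA.condError γ (π k) (m k) (S k) (fun j l => X k j l ω) i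
          - cdf (gaussianReal 0 1)
              ((-1 : ℝ) ^ (i : ℕ) *
                ((RQDA.xi γ (π k) (m k) (fun j l => X k j l ω) i
                    - (RQDA.matB γ (S k) (fun j l => X k j l ω) i).trace)
                  / √(RQDA.totalVar γ (m k) (S k) (fun j l => X k j l ω) i))))
        atTop (𝓝 0) := by
  intro i
  -- The argument is pathwise: for fixed `ω` the training samples form a deterministic sequence.
  filter_upwards [hcond i] with ω hω
  exact RQDA.tendsto_condError_sub_cdf hγ π m S hS (fun k j l => X k j l ω) i (hcov i) hω.1 hω.2
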